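/- Let $1\le N<M$, $K\ge 1$ and $B\ge 0$ be integers. Consider $K$ mobiles with channel matrices $\mathbf H_k\in\mathbb C^{M\times N}$ and codebooks $\mathbf w_{k,1},\dots,\mathbf w_{k,2^B}\in\mathbb C^M$ ($k=1,\dots,K$). All the entries of all the $\mathbf H_k$ are iid circularly symmetric complex Gaussian with unit variance ($E|\cdot|^2=1$), each $\mathbf w_{k,l}$ has the isotropic distribution on the unit sphere of $\mathbb C^M$, and all codebook vectors of all mobiles and all channel entries are mutually independent. Quantization-based combining (QBC) at mobile $k$ is the following procedure. Let $\mathbf P_k$ be the orthogonal projection onto the column span of $\mathbf H_k$; choose $\hat{\mathbf h}_k$ among $\mathbf w_{k,1},\dots,\mathbf w_{k,2^B}$ so that $\|\mathbf P_k\mathbf w\|$ is maximal, i.e. so that the angle between $\mathbf w$ and the column span of $\mathbf H_k$ is minimal (ties broken arbitrarily); put $$\mathbf s_k=\frac{\mathbf P_k\hat{\mathbf h}_k}{\|\mathbf P_k\hat{\mathbf h}_k\|},\qquad \mathbf u_k=(\mathbf H_k^H\mathbf H_k)^{-1}\mathbf H_k^H\mathbf s_k,\qquad \boldsymbol\gamma_k=\frac{\mathbf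 u_k}{\|\mathbf u_k\|},\qquad \mathbf h_k^{\mathrm{eff}}=\mathbf H_k\boldsymbol\gamma_k$$ (these are defined with probability one). Then for every $k$ the quantity $\|\mathbf h_k^{\mathrm{eff}}\|^2$ is $\chi^2_{2(M-N+1)}$ in the normalization in which $\chi^2_{2m}$ is the law of the squared norm of an $m$-dimensional vector with iid unit-variance complex Gaussian entries. That is, $\|\mathbf h_k^{\mathrm{eff}}\|^2$ has the same distribution as $\|\mathbf z\|^2$, where $\mathbf z\in\mathbb C^{M-N+1}$ has iid unit-variance complex Gaussian entries; equivalently, $2\|\mathbf h_k^{\mathrm{eff}}\|^2$ has the standard chi-squared distribution with $2(M-N+1)$ degrees of freedom (the law of a sum of $2(M-N+1)$ squares of independent real standard Gaussians). -/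

import Mathlib

open MeasureTheory ProbabilityTheory

namespace QBC

/-- Column vectors in `ℂⁿ` with the Euclidean norm. -/
abbrev CVec (n : ℕ) : Type := EuclideanSpace ℂ (Fin n)

/-! ### Distributions -/

/-- The circularly symmetric complex Gaussian law with unit variance: real and imaginary part are
independent, centred, real Gaussian with variance `1/2` each, so that `E |z|² = 1`. -/
noncomputable def complexGaussian : Measure ℂ :=
  ((gaussianReal 0 (1 / 2)).prod (gaussianReal 0 (1 / 2))).map
    (fun p : ℝ × ℝ => (⟨p.1, p.2⟩ : ℂ))

/-- The law of a vector in `ℂⁿ` whose coordinates are iid complex Gaussian with unit variance. -/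
noncomputable def gaussianVec (n : ℕ) : Measure (CVec n) :=
  (Measure.pi (fun _ : Fin n => complexGaussian)).map (WithLp.toLp 2)

/-- The (standard) chi-squared law with `d` degrees of freedom: the law of the sum of the squares
of `d` independent standard real Gaussians. -/
noncomputable def chiSquared (d : ℕ) : Measure ℝ :=
  (Measure.pi (fun _ : Fin d => gaussianReal 0 1)).map (fun x : Fin d → ℝ => ∑ i, x i ^ 2)

/-- The isotropic distribution on the unit sphere of `ℂⁿ`: a probability measure carried by the
unit sphere and invariant under every unitary map. -/
structure IsIsotropic {n : ℕ} (ν : Measure (CVec n)) : Prop where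
  prob : IsProbabilityMeasure ν
  unit_norm : ∀ᵐ v ∂ν, ‖v‖ = 1
  invariant : ∀ U : CVec n ≃ₗᵢ[ℂ] CVec n, ν.map U = ν

/-! ### The random channel and the random codebooks -/

/-- Downlink with `K` mobiles, `N` antennas per mobile, `M` transmit antennas, iid Rayleigh fading
and random vector quantization with `B` bits. `h k i` is the channel vector of the `i`-th antenna
of mobile `k` and `w k l` is the `l`-th quantization vector of mobile `k`. All the channel
coefficients are iid complex Gaussian with unit variance, all the quantization vectors are
isotropic, and all these random vectors are mutually independent. -/
structure IsDownlink {Ω : Type*} [MeasurableSpace Ω] (μ : Measure Ω) {K M N B : ℕ}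
    (h : Fin K → Fin N → Ω → CVec M) (w : Fin K → Fin (2 ^ B) → Ω → CVec M) : Prop where
  channel_law : ∀ k i, HasLaw (h k i) (gaussianVec M) μ
  codeword_aemeasurable : ∀ k l, AEMeasurable (w k l) μ
  codeword_isotropic : ∀ k l, IsIsotropic (μ.map (w k l))
  indep : iIndepFun
    (Sum.elim (fun p : Fin K × Fin N => h p.1 p.2)
      (fun q : Fin K × Fin (2 ^ B) => w q.1 q.2)) μ

/-! ### Quantization-based combining at one mobile -/

/-- The channel matrix `H = [h₁ ⋯ h_N]`. -/
def channelMatrix {M N : ℕ} (h : Fin N → CVec M) : Matrix (Fin M) (Fin N) ℂ :=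
  Matrix.of fun j i => h i j

/-- The orthogonal projection of `v` on `span(H)`, the span of the columns of `H`. It is
`Q Qᴴ v` if the columns of `Q` are an orthonormal basis of `span(H)`, and its norm is `‖Qᴴ v‖`. -/
noncomputable def proj {M N : ℕ} (h : Fin N → CVec M) (v : CVec M) : CVec M :=
  (Submodule.span ℂ (Set.range h)).starProjection v

/-- `l` is the index of a quantization vector closest in angle to `span(H)`, that is, a
maximizer of `‖Qᴴ w_l‖²`. -/
def IsSelected {M N L : ℕ} (h : Fin N → CVec M) (w : Fin L → CVec M) (l : Fin L) : Prop :=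
  ∀ l' : Fin L, ‖proj h (w l')‖ ^ 2 ≤ ‖proj h (w l)‖ ^ 2

/-- The vector `x / ‖x‖`. -/
noncomputable def normalized {n : ℕ} (x : CVec n) : CVec n := ((‖x‖⁻¹ : ℝ) : ℂ) • x

/-- The vector `u = (Hᴴ H)⁻¹ Hᴴ s`, where `s` is the normalized projection of the selected
quantization vector `v` on `span(H)`. -/
noncomputable def coeff {M N : ℕ} (h : Fin N → CVec M) (v : CVec M) : CVec N :=
  WithLp.toLp 2
    ((((channelMatrix h).conjTranspose * channelMatrix h)⁻¹ *
      (channelMatrix h).conjTranspose).mulVec (normalized (proj h v)).ofLp)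

/-- The combiner weights `γ = u / ‖u‖`. -/
noncomputable def weights {M N : ℕ} (h : Fin N → CVec M) (v : CVec M) : CVec N :=
  normalized (coeff h v)

/-- The effective channel `h_eff = H γ`, when `v` is the selected quantization vector. -/
noncomputable def effChannel {M N : ℕ} (h : Fin N → CVec M) (v : CVec M) : CVec M :=
  WithLp.toLp 2 ((channelMatrix h).mulVec (weights h v).ofLp)

end QBC

namespace QBC
open scoped InnerProductSpace ENNReal

/-! Write `W = Hᴴ H` and let `v` be the selected codeword. Both normalizations in QBC only rescale,
so the squared norm of the effective channel is `‖P v‖² / ‖W⁻¹ Hᴴ v‖²` (`norm_effChannel_sq`). The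
polar decomposition `H = J √W` (`exists_polar`) turns this into `1 / (bᴴ W⁻¹ b)`, where `b` is the
direction of `Jᴴ v`, the coordinate vector of `P v`.

Fix `H`. Selection depends only on the norms `‖Jᴴ w_l‖`, and every unitary map of `ℂᴺ` lifts through
`J` to a unitary map of `ℂᴹ` preserving the codebook law. Hence `b` is isotropic whatever `H` is
(`map_atMax_gain_codebookLaw`): choosing the best codeword does not bias the direction inside the
column span.

By Fubini `b` may now be fixed instead. Since `H V` has the law of `H` for unitary `V`, it may be
taken to be the first basis vector (`map_invForm_channelLaw`). Then `1 / (bᴴ W⁻¹ b)` is the squared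
distance of the first column from the span of the other `N - 1` (`inv_invForm_single`). Given those
columns, it is the squared norm of a Gaussian vector projected on a space of dimension `M - N + 1`.
-/

lemma real_inner_eq_re {n : ℕ} (x y : CVec n) : ⟪x, y⟫_ℝ = (⟪x, y⟫_ℂ).re := by
  simp [PiLp.inner_apply, Complex.inner]

/-! ### Complex Gaussian vectors and their characteristic functions -/

lemma measurable_complexMk : Measurable (fun p : ℝ × ℝ => (⟨p.1, p.2⟩ : ℂ)) :=
  Complex.measurableEquivRealProd.symm.measurable

instance isProbabilityMeasure_complexGaussian : IsProbabilityMeasure complexGaussian :=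
  Measure.isProbabilityMeasure_map measurable_complexMk.aemeasurable

lemma measurable_toLp_pi {n : ℕ} : Measurable (WithLp.toLp 2 : (Fin n → ℂ) → CVec n) :=
  (MeasurableEquiv.toLp 2 (Fin n → ℂ)).measurable

instance isProbabilityMeasure_gaussianVec (n : ℕ) : IsProbabilityMeasure (gaussianVec n) :=
  Measure.isProbabilityMeasure_map measurable_toLp_pi.aemeasurable

lemma charFun_complexGaussian (t : ℂ) :
    charFun complexGaussian t = Complex.exp (-(‖t‖ ^ 2 : ℝ) / 4) := by
  rw [charFun_apply, complexGaussian, integral_map measurable_complexMk.aemeasurable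
    (Measurable.aestronglyMeasurable (by fun_prop))]
  have h1 : ∀ p : ℝ × ℝ, Complex.exp ((⟪(⟨p.1, p.2⟩ : ℂ), t⟫_ℝ : ℝ) * Complex.I) =
      Complex.exp (t.re * p.1 * Complex.I) * Complex.exp (t.im * p.2 * Complex.I) := by
    intro p
    rw [← Complex.exp_add]
    congr 1
    simp [Complex.inner]
    ring
  simp_rw [h1]
  rw [integral_prod_mul (fun x : ℝ => Complex.exp (t.re * x * Complex.I))
    (fun x : ℝ => Complex.exp (t.im * x * Complex.I)), ← charFun_apply_real,
    ← charFun_apply_real, charFun_gaussianReal, charFun_gaussianReal, ← Complex.exp_add]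
  congr 1
  rw [Complex.sq_norm, Complex.normSq_apply]
  push_cast
  ring

lemma charFun_gaussianVec {n : ℕ} (t : CVec n) :
    charFun (gaussianVec n) t = Complex.exp (-(‖t‖ ^ 2 : ℝ) / 4) := by
  rw [gaussianVec, charFun_pi]
  simp_rw [charFun_complexGaussian]
  rw [← Complex.exp_sum, EuclideanSpace.norm_sq_eq]
  push_cast
  rw [← Finset.sum_div, Finset.sum_neg_distrib]

/-- The image of a complex Gaussian vector under a map whose adjoint is isometric is again
a complex Gaussian vector. -/
lemma map_gaussianVec_of_norm_adjoint {n m : ℕ} (A : CVec n →ₗ[ℂ] CVec m)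
    (B : CVec m →ₗ[ℂ] CVec n) (hAB : ∀ x y, ⟪A x, y⟫_ℂ = ⟪x, B y⟫_ℂ) (hB : ∀ y, ‖B y‖ = ‖y‖) :
    (gaussianVec n).map A = gaussianVec m := by
  have hA : Measurable A := A.continuous_of_finiteDimensional.measurable
  have := Measure.isProbabilityMeasure_map (μ := gaussianVec n) hA.aemeasurable
  refine Measure.ext_of_charFun (funext fun t => ?_)
  rw [charFun_gaussianVec, ← hB, ← charFun_gaussianVec, charFun_apply, charFun_apply,
    integral_map hA.aemeasurable (Measurable.aestronglyMeasurable (by fun_prop))]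
  simp_rw [real_inner_eq_re, hAB]

lemma map_gaussianVec_linearIsometryEquiv {n : ℕ} (U : CVec n ≃ₗᵢ[ℂ] CVec n) :
    (gaussianVec n).map U = gaussianVec n :=
  map_gaussianVec_of_norm_adjoint U.toLinearEquiv.toLinearMap U.symm.toLinearEquiv.toLinearMap
    (fun x y => by
      have := U.inner_map_map x (U.symm y)
      simpa using this) (fun y => by simp)

/-! ### Gaussian null sets -/

lemma absolutelyContinuous_pi {n : ℕ} {α : Type*} [MeasurableSpace α] {μ ν : Measure α}
    [SigmaFinite μ] [SigmaFinite ν] (h : μ ≪ ν) :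
    Measure.pi (fun _ : Fin n => μ) ≪ Measure.pi (fun _ : Fin n => ν) := by
  induction n with
  | zero => rw [Measure.pi_of_empty, Measure.pi_of_empty]
  | succ n ih =>
    rw [← (measurePreserving_piFinSuccAbove (fun _ : Fin (n + 1) => μ) 0).symm.map_eq,
      ← (measurePreserving_piFinSuccAbove (fun _ : Fin (n + 1) => ν) 0).symm.map_eq]
    exact (h.prod ih).map (MeasurableEquiv.measurable _)

lemma complexGaussian_absolutelyContinuous : complexGaussian ≪ volume := by
  rw [← Complex.volume_preserving_equiv_real_prod.symm.map_eq, Measure.volume_eq_prod]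
  exact ((gaussianReal_absolutelyContinuous 0 (by norm_num)).prod
    (gaussianReal_absolutelyContinuous 0 (by norm_num))).map measurable_complexMk

lemma exists_gaussianVec_absolutelyContinuous (n : ℕ) :
    ∃ ν : Measure (CVec n), ν.IsAddHaarMeasure ∧ gaussianVec n ≪ ν :=
  ⟨(volume : Measure (Fin n → ℂ)).map
    (PiLp.continuousLinearEquiv 2 ℂ (fun _ : Fin n => ℂ)).symm,
    ContinuousLinearEquiv.isAddHaarMeasure_map _ _,
    (absolutelyContinuous_pi complexGaussian_absolutelyContinuous).map measurable_toLp_pi⟩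

lemma ae_gaussianVec_notMem_submodule {n : ℕ} (S : Submodule ℂ (CVec n)) (hS : S ≠ ⊤) :
    ∀ᵐ x ∂gaussianVec n, x ∉ S := by
  obtain ⟨ν, hν, hac⟩ := exists_gaussianVec_absolutelyContinuous n
  suffices h : ∀ᵐ x ∂ν, x ∉ S from hac.ae_le h
  rw [ae_iff]
  have := Measure.addHaar_submodule ν (S.restrictScalars ℝ)
    (fun h => hS (by rwa [Submodule.restrictScalars_eq_top_iff] at h))
  simpa using this

lemma ae_gaussianVec_ne_zero {n : ℕ} (hn : 1 ≤ n) : ∀ᵐ x ∂gaussianVec n, x ≠ 0 := by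
  have : Nonempty (Fin n) := ⟨⟨0, hn⟩⟩
  have := ae_gaussianVec_notMem_submodule (⊥ : Submodule ℂ (CVec n)) bot_ne_top
  simpa using this

/-- For a proper nonzero subspace `S`, the quadric `‖P_S x‖² = c ‖x‖²` is a Gaussian null set. -/
lemma ae_gaussianVec_norm_starProjection_ne {n : ℕ} (S : Submodule ℂ (CVec n)) (hS : S ≠ ⊤)
    (hS' : S ≠ ⊥) (c : ℝ) :
    ∀ᵐ x ∂gaussianVec n, ‖S.starProjection x‖ ^ 2 ≠ c * ‖x‖ ^ 2 := by
  -- An eigenvector `d` of the projection, with eigenvalue 1 or 0 chosen so that `r ^ 2 ≠ c`. Then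
  -- the quadric equation has a nonzero leading coefficient along every line in direction `d`.
  obtain ⟨d, hd0, r, hr, hrc⟩ : ∃ d : CVec n, d ≠ 0 ∧ ∃ r : ℝ,
      S.starProjection d = (r : ℂ) • d ∧ r ^ 2 - c ≠ 0 := by
    by_cases hc : c = 0
    · obtain ⟨d, hd, hd0⟩ := S.ne_bot_iff.mp hS'
      exact ⟨d, hd0, 1, by simpa using S.starProjection_eq_self_iff.mpr hd, by simp [hc]⟩
    · have : Sᗮ ≠ ⊥ := by rwa [ne_eq, Submodule.orthogonal_eq_bot_iff]
      obtain ⟨d, hd, hd0⟩ := Sᗮ.ne_bot_iff.mp this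
      exact ⟨d, hd0, 0, by
        simpa using (S.starProjection_apply_eq_zero_iff).mpr hd, by simpa using hc⟩
  obtain ⟨ν, hν, hac⟩ := exists_gaussianVec_absolutelyContinuous n
  have hmeas : MeasurableSet {x : CVec n | ‖S.starProjection x‖ ^ 2 ≠ c * ‖x‖ ^ 2} :=
    (measurableSet_eq_fun (by fun_prop) (by fun_prop)).compl
  suffices h : ∀ᵐ x ∂ν, x ∈ {x : CVec n | ‖S.starProjection x‖ ^ 2 ≠ c * ‖x‖ ^ 2} from
    hac.ae_le h
  -- Fubini along the lines `y + x d`: each meets the quadric only in the roots of the nonzero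
  -- quadratic `q`.
  refine ae_mem_of_ae_add_linearMap_mem (𝕜 := ℝ) ((LinearMap.id (R := ℝ) (M := ℝ)).smulRight d)
    volume ν hmeas (fun y => ?_)
  set q : Polynomial ℝ := Polynomial.C ((r ^ 2 - c) * ‖d‖ ^ 2) * Polynomial.X ^ 2 +
    Polynomial.C (2 * ⟪S.starProjection y, S.starProjection d⟫_ℝ - c * (2 * ⟪y, d⟫_ℝ)) *
      Polynomial.X + Polynomial.C (‖S.starProjection y‖ ^ 2 - c * ‖y‖ ^ 2) with hq
  have hq0 : q ≠ 0 := by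
    intro h0
    have := congrArg (fun p => Polynomial.coeff p 2) h0
    simp only [hq, Polynomial.coeff_add, Polynomial.coeff_C_mul_X_pow, Polynomial.coeff_C_mul_X,
      Polynomial.coeff_C] at this
    simp at this
    tauto
  have hfin : (q.rootSet ℝ).Finite := Polynomial.rootSet_finite q ℝ
  filter_upwards [hfin.countable.ae_notMem volume] with x hx
  contrapose! hx
  rw [Polynomial.mem_rootSet]
  refine ⟨hq0, ?_⟩
  simp only [LinearMap.smulRight_apply, LinearMap.id_apply] at hx
  have e1 := S.starProjection.map_smul_of_tower x d
  rw [map_add, e1, norm_add_sq_real, norm_add_sq_real, norm_smul, norm_smul, inner_smul_right,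
    inner_smul_right] at hx
  have e2 : ‖S.starProjection d‖ ^ 2 = r ^ 2 * ‖d‖ ^ 2 := by
    rw [hr, norm_smul, mul_pow]; simp
  simp only [mul_pow, e2, Real.norm_eq_abs, sq_abs] at hx
  simp [hq]
  linarith

/-! ### Isotropic distributions on the unit sphere -/

lemma exists_orthonormalBasis_apply_eq {n : ℕ} (i : Fin n) {x : CVec n} (hx : ‖x‖ = 1) :
    ∃ b : OrthonormalBasis (Fin n) ℂ (CVec n), b i = x := by
  obtain ⟨b, hb⟩ := Orthonormal.exists_orthonormalBasis_extension_of_card_eq (𝕜 := ℂ)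
    (E := CVec n) (ι := Fin n) (by simp) (v := fun _ => x) (s := {i})
    ⟨fun _ => hx, fun j k hjk => absurd (Subsingleton.elim j k) hjk⟩
  exact ⟨b, hb i rfl⟩

/-- The unitary group acts transitively on spheres. -/
lemma exists_linearIsometryEquiv_apply_eq {n : ℕ} {x y : CVec n} (h : ‖x‖ = ‖y‖) :
    ∃ U : CVec n ≃ₗᵢ[ℂ] CVec n, U x = y := by
  by_cases hx : x = 0
  · have hy : y = 0 := by rw [← norm_eq_zero, ← h, hx, norm_zero]
    exact ⟨LinearIsometryEquiv.refl ℂ _, by simp [hx, hy]⟩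
  have hy : y ≠ 0 := fun hy => hx (by rw [← norm_eq_zero, h, hy, norm_zero])
  obtain ⟨i⟩ : Nonempty (Fin n) := by
    by_contra hn
    rw [not_nonempty_iff] at hn
    exact hx (Subsingleton.elim _ _)
  obtain ⟨b, hb⟩ := exists_orthonormalBasis_apply_eq i
    (x := ((‖x‖⁻¹ : ℝ) : ℂ) • x) (by rw [norm_smul]; simp [hx])
  obtain ⟨c, hc⟩ := exists_orthonormalBasis_apply_eq i
    (x := ((‖x‖⁻¹ : ℝ) : ℂ) • y) (by rw [norm_smul, h]; simp [hy])
  refine ⟨b.equiv c (Equiv.refl _), ?_⟩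
  have h1 : b.equiv c (Equiv.refl _) (b i) = c i := by simp
  rw [hb, hc, map_smul] at h1
  exact smul_right_injective _ (by simpa using hx) h1

lemma IsIsotropic.charFun_eq_of_norm_eq {n : ℕ} {ν : Measure (CVec n)} (hν : IsIsotropic ν)
    {s t : CVec n} (h : ‖s‖ = ‖t‖) : charFun ν s = charFun ν t := by
  obtain ⟨U, rfl⟩ := exists_linearIsometryEquiv_apply_eq h
  rw [← hν.invariant U, charFun_apply, charFun_apply,
    integral_map (by fun_prop) (by fun_prop), integral_map (by fun_prop) (by fun_prop),
    ← integral_map (μ := ν) (φ := U) (f := fun x => Complex.exp ((⟪x, s⟫_ℝ : ℝ) * Complex.I))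
      (by fun_prop) (by fun_prop), hν.invariant U]
  simp_rw [real_inner_eq_re, U.inner_map_map]

/-- The characteristic function of an isotropic law is radial, so its value at `t` is also its
average over the points `‖t‖ • y` with `y` drawn from the other law. The resulting double integral
is symmetric in the two laws. -/
lemma IsIsotropic.eq {n : ℕ} {ν₁ ν₂ : Measure (CVec n)} (h₁ : IsIsotropic ν₁)
    (h₂ : IsIsotropic ν₂) : ν₁ = ν₂ := by
  have := h₁.prob
  have := h₂.prob
  refine Measure.ext_of_charFun (funext fun t => ?_)
  have key : ∀ {μ ν : Measure (CVec n)}, IsIsotropic μ → IsIsotropic ν →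
      charFun μ t = ∫ y, ∫ x, Complex.exp ((⟪x, ‖t‖ • y⟫_ℝ : ℝ) * Complex.I) ∂μ ∂ν := by
    intro μ ν hμ hν
    have := hν.prob
    have h3 : ∀ᵐ y ∂ν, charFun μ (‖t‖ • y) = charFun μ t := by
      filter_upwards [hν.unit_norm] with y hy
      exact hμ.charFun_eq_of_norm_eq (by rw [norm_smul, hy]; simp)
    simp_rw [← charFun_apply]
    rw [integral_congr_ae h3]
    simp
  rw [key h₁ h₂, key h₂ h₁, integral_integral_swap]
  · simp_rw [inner_smul_right, real_inner_comm]
  · refine (integrable_const (1 : ℝ)).mono (by fun_prop) ?_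
    refine Filter.Eventually.of_forall fun p => ?_
    simp [Function.uncurry, Complex.norm_exp_ofReal_mul_I]

lemma measurable_normalized {n : ℕ} : Measurable (normalized : CVec n → CVec n) := by
  unfold normalized
  fun_prop

lemma norm_normalized {n : ℕ} {x : CVec n} (hx : x ≠ 0) : ‖normalized x‖ = 1 := by
  rw [normalized, norm_smul]
  simp [hx]

lemma map_normalized {n : ℕ} (U : CVec n ≃ₗᵢ[ℂ] CVec n) (x : CVec n) :
    U (normalized x) = normalized (U x) := by
  rw [normalized, normalized, map_smul, U.norm_map]

/-- The isotropic distribution on the unit sphere. -/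
noncomputable def sphereLaw (n : ℕ) : Measure (CVec n) := (gaussianVec n).map normalized

instance isProbabilityMeasure_sphereLaw (n : ℕ) : IsProbabilityMeasure (sphereLaw n) :=
  Measure.isProbabilityMeasure_map measurable_normalized.aemeasurable

lemma isIsotropic_sphereLaw {n : ℕ} (hn : 1 ≤ n) : IsIsotropic (sphereLaw n) where
  prob := inferInstance
  unit_norm := by
    rw [sphereLaw, ae_map_iff measurable_normalized.aemeasurable
      (measurableSet_eq_fun (by fun_prop) (by fun_prop))]
    filter_upwards [ae_gaussianVec_ne_zero hn] with x hx using norm_normalized hx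
  invariant U := by
    have hU : Measurable U := by fun_prop
    rw [sphereLaw, Measure.map_map hU measurable_normalized]
    conv_rhs => rw [← map_gaussianVec_linearIsometryEquiv U,
      Measure.map_map measurable_normalized hU]
    exact congrArg (fun f => Measure.map f _) (funext (map_normalized U))

/-- By homogeneity, the level set on the sphere pulls back to a quadric cone, which is Gaussian
null. -/
lemma ae_sphereLaw_norm_starProjection_ne {n : ℕ} (S : Submodule ℂ (CVec n))
    (hS : S ≠ ⊤) (hS' : S ≠ ⊥) (c : ℝ) :
    ∀ᵐ x ∂sphereLaw n, ‖S.starProjection x‖ ^ 2 ≠ c := by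
  have hmeas : MeasurableSet {x : CVec n | ‖S.starProjection x‖ ^ 2 ≠ c} :=
    (measurableSet_eq_fun (by fun_prop) (by fun_prop)).compl
  rw [sphereLaw, ae_map_iff measurable_normalized.aemeasurable hmeas]
  have hbot := ae_gaussianVec_notMem_submodule (⊥ : Submodule ℂ (CVec n))
    (fun h => hS' (le_bot_iff.mp (h ▸ le_top)))
  filter_upwards [ae_gaussianVec_norm_starProjection_ne S hS hS' c, hbot] with x hx hx0 h
  have hx0 : ‖x‖ ≠ 0 := by simpa using hx0
  apply hx
  rw [normalized, map_smul, norm_smul, mul_pow] at h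
  rw [← h]
  simp
  field_simp

/-! ### The chi-squared law as the law of a squared norm -/

lemma gaussianReal_zero_one_eq_map :
    gaussianReal 0 1 = (gaussianReal 0 (1 / 2)).map (fun x => √2 * x) := by
  rw [gaussianReal_map_const_mul]
  congr 1
  · simp
  · ext; simp

/-- Real and imaginary parts have variance `1/2`, so the factor 2 makes them standard. Both
characteristic functions are the `2 * m`-th power of one and the same Gaussian integral. -/
lemma chiSquared_two_mul (m : ℕ) :
    chiSquared (2 * m) = (gaussianVec m).map (fun z => 2 * ‖z‖ ^ 2) := by
  have hm1 : Measurable (fun x : Fin (2 * m) → ℝ => ∑ i, x i ^ 2) := by fun_prop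
  have hm2 : Measurable (fun z : CVec m => 2 * ‖z‖ ^ 2) := by fun_prop
  have : IsProbabilityMeasure (chiSquared (2 * m)) :=
    Measure.isProbabilityMeasure_map hm1.aemeasurable
  have := Measure.isProbabilityMeasure_map (μ := gaussianVec m) hm2.aemeasurable
  refine Measure.ext_of_charFun (funext fun t => ?_)
  set f : ℝ → ℂ := fun x => Complex.exp (t * (2 * (x : ℂ) ^ 2) * Complex.I) with hf
  have h1 : charFun (chiSquared (2 * m)) t = (∫ x, f x ∂gaussianReal 0 (1 / 2)) ^ (2 * m) := by
    rw [charFun_apply_real, chiSquared, integral_map hm1.aemeasurable (by fun_prop)]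
    have : ∀ x : Fin (2 * m) → ℝ, Complex.exp (t * ((∑ i, x i ^ 2 : ℝ) : ℂ) * Complex.I) =
        ∏ i, Complex.exp (t * ((x i : ℂ) ^ 2) * Complex.I) := by
      intro x
      rw [← Complex.exp_sum]
      push_cast
      rw [Finset.mul_sum, Finset.sum_mul]
    simp_rw [this]
    rw [integral_fintype_prod_eq_pow (fun x : ℝ => Complex.exp (t * ((x : ℂ) ^ 2) * Complex.I)),
      Fintype.card_fin, gaussianReal_zero_one_eq_map,
      integral_map (by fun_prop) (by fun_prop)]
    congr 2
    ext x
    rw [hf]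
    have h2 : ((√2 : ℝ) : ℂ) ^ 2 = 2 := by norm_cast; simp
    simp only
    push_cast
    rw [mul_pow, h2]
  have h2 : charFun ((gaussianVec m).map (fun z => 2 * ‖z‖ ^ 2)) t =
      (∫ z : ℂ, f z.re * f z.im ∂complexGaussian) ^ m := by
    rw [charFun_apply_real, integral_map hm2.aemeasurable (by fun_prop), gaussianVec,
      integral_map measurable_toLp_pi.aemeasurable (by fun_prop)]
    have : ∀ x : Fin m → ℂ, Complex.exp (t * ((2 * ‖(WithLp.toLp 2 x : CVec m)‖ ^ 2 : ℝ) : ℂ) *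
        Complex.I) = ∏ i, (f (x i).re * f (x i).im) := by
      intro x
      simp only [hf, ← Complex.exp_add, ← Complex.exp_sum, EuclideanSpace.norm_sq_eq,
        Complex.sq_norm, Complex.normSq_apply]
      push_cast
      rw [Finset.mul_sum, Finset.mul_sum, Finset.sum_mul]
      congr 1
      exact Finset.sum_congr rfl fun i _ => by ring
    simp_rw [this]
    rw [integral_fintype_prod_eq_pow (fun z : ℂ => f z.re * f z.im), Fintype.card_fin]
  rw [h1, h2, complexGaussian, integral_map measurable_complexMk.aemeasurable (by fun_prop),
    integral_prod_mul, ← sq, ← pow_mul]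

/-! ### The Gaussian channel matrix -/

/-- The law of `N` independent complex Gaussian vectors in `ℂᴹ`. -/
noncomputable def channelLaw (N M : ℕ) : Measure (Fin N → CVec M) :=
  Measure.pi fun _ => gaussianVec M

instance isProbabilityMeasure_channelLaw (N M : ℕ) : IsProbabilityMeasure (channelLaw N M) := by
  unfold channelLaw; infer_instance

lemma continuous_gram {N M : ℕ} : Continuous (fun h : Fin N → CVec M => Matrix.gram ℂ h) :=
  continuous_matrix fun i j => by simp only [Matrix.gram_apply]; fun_prop

lemma measurable_det_gram {N M : ℕ} :
    Measurable (fun h : Fin N → CVec M => (Matrix.gram ℂ h).det) :=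
  continuous_gram.matrix_det.measurable

lemma measurable_gram_inv_apply {N M : ℕ} (i j : Fin N) :
    Measurable (fun h : Fin N → CVec M => (Matrix.gram ℂ h)⁻¹ i j) := by
  simp only [Matrix.inv_def, Matrix.smul_apply, Ring.inverse_eq_inv', smul_eq_mul]
  have h1 := (continuous_gram (N := N) (M := M)).matrix_adjugate
  exact measurable_det_gram.inv.mul (h1.matrix_elem i j).measurable

lemma measurableSet_linearIndependent {N M : ℕ} :
    MeasurableSet {h : Fin N → CVec M | LinearIndependent ℂ h} := by
  simp_rw [← Matrix.det_gram_ne_zero_iff_linearIndependent]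
  exact (measurableSet_eq_fun measurable_det_gram measurable_const).compl

lemma span_range_ne_top {N M : ℕ} (hNM : N < M) (h : Fin N → CVec M) :
    Submodule.span ℂ (Set.range h) ≠ ⊤ := by
  intro h0
  have h1 := finrank_range_le_card (R := ℂ) h
  rw [Set.finrank, h0, finrank_top, finrank_euclideanSpace_fin, Fintype.card_fin] at h1
  omega

lemma map_cons_channelLaw (N M : ℕ) :
    ((gaussianVec M).prod (channelLaw N M)).map (fun p => (Fin.cons p.1 p.2 : Fin (N + 1) → CVec M))
      = channelLaw (N + 1) M := by
  have := (measurePreserving_piFinSuccAbove (fun _ : Fin (N + 1) => gaussianVec M) 0).symm.map_eq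
  rw [channelLaw, channelLaw, ← this]
  congr 1
  ext p : 1
  exact (Fin.insertNth_zero' (β := CVec M) p.1 p.2).symm

lemma measurable_cons {N M : ℕ} :
    Measurable (fun p : CVec M × (Fin N → CVec M) => (Fin.cons p.1 p.2 : Fin (N + 1) → CVec M)) := by
  refine measurable_pi_lambda _ fun i => ?_
  refine Fin.cases ?_ (fun j => ?_) i
  · simpa using measurable_fst
  · simp only [Fin.cons_succ]
    fun_prop

/-- Induction on the columns: a new Gaussian column almost surely avoids the proper subspace spanned
by the others. -/
lemma ae_linearIndependent_channelLaw {N M : ℕ} (hNM : N ≤ M) :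
    ∀ᵐ h ∂channelLaw N M, LinearIndependent ℂ h := by
  induction N with
  | zero => exact Filter.Eventually.of_forall fun h => linearIndependent_empty_type
  | succ N ih =>
    rw [← map_cons_channelLaw, ae_map_iff measurable_cons.aemeasurable
      measurableSet_linearIndependent]
    have hmeas : MeasurableSet {p : CVec M × (Fin N → CVec M) |
        LinearIndependent ℂ (Fin.cons p.1 p.2 : Fin (N + 1) → CVec M)} :=
      measurable_cons measurableSet_linearIndependent
    refine (Measure.ae_prod_mem_iff_ae_ae_mem hmeas).2 ((Measure.ae_ae_comm hmeas).2 ?_)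
    filter_upwards [ih (by omega)] with h hh
    filter_upwards [ae_gaussianVec_notMem_submodule _ (span_range_ne_top (by omega) h)] with x hx
    exact linearIndependent_finCons.mpr ⟨hh, hx⟩

/-! ### Unitary mixing of the columns and the inverse Gram form -/

/-- The family `i ↦ ∑ⱼ Vⱼᵢ hⱼ`, that is, the columns of `H V`. -/
noncomputable def mix {N M : ℕ} (V : Matrix (Fin N) (Fin N) ℂ) (h : Fin N → CVec M) :
    Fin N → CVec M :=
  fun i => ∑ j, V j i • h j

lemma measurable_mix {N M : ℕ} (V : Matrix (Fin N) (Fin N) ℂ) :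
    Measurable (mix V : (Fin N → CVec M) → _) := by
  unfold mix; fun_prop

lemma mix_mix {N M : ℕ} (V X : Matrix (Fin N) (Fin N) ℂ) (h : Fin N → CVec M) :
    mix V (mix X h) = mix (X * V) h := by
  ext1 i
  simp_rw [mix, Finset.smul_sum, Matrix.mul_apply, Finset.sum_smul, smul_smul]
  rw [Finset.sum_comm]
  simp_rw [mul_comm]

lemma mix_one {N M : ℕ} (h : Fin N → CVec M) : mix 1 h = h := by
  ext1 i
  simp [mix, Matrix.one_apply]

lemma sum_inner_mix {N M : ℕ} (V : Matrix (Fin N) (Fin N) ℂ) (h t : Fin N → CVec M) :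
    ∑ i, ⟪mix V h i, t i⟫_ℂ = ∑ i, ⟪h i, mix V.conjTranspose t i⟫_ℂ := by
  simp_rw [mix, sum_inner, inner_sum, inner_smul_left, inner_smul_right]
  rw [Finset.sum_comm]
  rfl

lemma sum_norm_sq_mix {N M : ℕ} {V : Matrix (Fin N) (Fin N) ℂ} (hV : V * V.conjTranspose = 1)
    (t : Fin N → CVec M) : ∑ i, ‖mix V t i‖ ^ 2 = ∑ i, ‖t i‖ ^ 2 := by
  have h := sum_inner_mix V t (mix V t)
  rw [mix_mix, hV, mix_one] at h
  simp_rw [inner_self_eq_norm_sq_to_K] at h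
  exact_mod_cast h

/-- The channel law is invariant under `H ↦ H V` for unitary `V`. -/
lemma map_mix_channelLaw {N M : ℕ} {V : Matrix (Fin N) (Fin N) ℂ}
    (hV : V.conjTranspose * V = 1) : (channelLaw N M).map (mix V) = channelLaw N M := by
  have hp := Measure.isProbabilityMeasure_map (μ := channelLaw N M) (measurable_mix V).aemeasurable
  have hL := (MeasurableEquiv.toLp 2 (Fin N → CVec M)).measurable
  -- The product carries the sup norm; its `PiLp 2` copy is an inner product space, where
  -- characteristic functions determine the law.
  refine (MeasurableEquiv.toLp 2 (Fin N → CVec M)).map_measurableEquiv_injective ?_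
  have := Measure.isProbabilityMeasure_map (μ := channelLaw N M) hL.aemeasurable
  have := Measure.isProbabilityMeasure_map (μ := (channelLaw N M).map (mix V)) hL.aemeasurable
  refine Measure.ext_of_charFun (E := PiLp 2 fun _ : Fin N => CVec M) (funext fun t => ?_)
  have key : ∀ s : PiLp 2 fun _ : Fin N => CVec M,
      charFun ((channelLaw N M).map (MeasurableEquiv.toLp 2 (Fin N → CVec M))) s =
        Complex.exp (-(∑ i, ‖s i‖ ^ 2 : ℝ) / 4) := by
    intro s
    rw [channelLaw, MeasurableEquiv.coe_toLp, charFun_pi]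
    simp_rw [charFun_gaussianVec]
    rw [← Complex.exp_sum]
    push_cast
    rw [← Finset.sum_div, Finset.sum_neg_distrib]
  rw [key, ← sum_norm_sq_mix (V := V.conjTranspose) (by rwa [Matrix.conjTranspose_conjTranspose])]
  trans charFun ((channelLaw N M).map (MeasurableEquiv.toLp 2 (Fin N → CVec M)))
    (WithLp.toLp 2 (mix V.conjTranspose t.ofLp))
  · rw [charFun_apply, charFun_apply, integral_map hL.aemeasurable (by fun_prop),
      integral_map (measurable_mix V).aemeasurable (by fun_prop),
      integral_map hL.aemeasurable (by fun_prop)]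
    congr with h
    have := congrArg Complex.re (sum_inner_mix V h t.ofLp)
    simp only [Complex.re_sum, ← real_inner_eq_re] at this
    simp only [MeasurableEquiv.coe_toLp, PiLp.inner_apply (𝕜 := ℝ) (f := fun _ : Fin N => CVec M)]
    rw [this]
  · rw [key]

/-- The quadratic form `bᴴ (Hᴴ H)⁻¹ b`. -/
noncomputable def invForm {N M : ℕ} (h : Fin N → CVec M) (b : CVec N) : ℝ :=
  (star b.ofLp ⬝ᵥ (Matrix.gram ℂ h)⁻¹.mulVec b.ofLp).re

lemma measurable_invForm {N M : ℕ} {α : Type*} [MeasurableSpace α] {f : α → Fin N → CVec M}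
    {g : α → CVec N} (hf : Measurable f) (hg : Measurable g) :
    Measurable fun x => invForm (f x) (g x) := by
  unfold invForm
  simp only [dotProduct, Matrix.mulVec, Pi.star_apply]
  have h1 : ∀ i j : Fin N, Measurable fun x => (Matrix.gram ℂ (f x))⁻¹ i j :=
    fun i j => (measurable_gram_inv_apply i j).comp hf
  have h2 : ∀ i : Fin N, Measurable fun x => (g x).ofLp i :=
    fun i => (by fun_prop : Measurable fun b : CVec N => b.ofLp i).comp hg
  exact Complex.measurable_re.comp (Finset.measurable_sum _ fun i _ =>
    (continuous_star.measurable.comp (h2 i)).mul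
      (Finset.measurable_sum _ fun j _ => (h1 i j).mul (h2 j)))

lemma gram_mix {N M : ℕ} (V : Matrix (Fin N) (Fin N) ℂ) (h : Fin N → CVec M) :
    Matrix.gram ℂ (mix V h) = V.conjTranspose * Matrix.gram ℂ h * V := by
  ext i k
  simp only [Matrix.gram_apply, mix, sum_inner, inner_sum, inner_smul_left, inner_smul_right,
    Matrix.mul_apply, Matrix.conjTranspose_apply, Finset.sum_mul]
  refine Finset.sum_congr rfl fun j _ => ?_
  rw [Finset.mul_sum]
  refine Finset.sum_congr rfl fun l _ => ?_
  simp only [starRingEnd_apply]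
  ring

lemma invForm_mix {N M : ℕ} {V : Matrix (Fin N) (Fin N) ℂ} (hV : V.conjTranspose * V = 1)
    (h : Fin N → CVec M) (b : CVec N) :
    invForm (mix V h) b = invForm h (WithLp.toLp 2 (V.mulVec b.ofLp)) := by
  have h1 : V⁻¹ = V.conjTranspose := Matrix.inv_eq_left_inv hV
  have h2 : V.conjTranspose⁻¹ = V := Matrix.inv_eq_right_inv hV
  rw [invForm, invForm, gram_mix, Matrix.mul_inv_rev, Matrix.mul_inv_rev, h1, h2]
  simp only [Matrix.star_mulVec, ← Matrix.mulVec_mulVec]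
  rw [← Matrix.dotProduct_mulVec]

/-- For every unit vector `b`, the form `bᴴ (Hᴴ H)⁻¹ b` has the same law as for a basis vector. -/
lemma map_invForm_channelLaw {N M : ℕ} (i : Fin N) {b : CVec N} (hb : ‖b‖ = 1) :
    (channelLaw N M).map (fun h => invForm h b) =
      (channelLaw N M).map (fun h => invForm h (EuclideanSpace.single i 1)) := by
  obtain ⟨e, he⟩ := exists_orthonormalBasis_apply_eq i hb
  -- The unitary matrix with columns `e j`; its `i`-th column is `b`, so it sends the `i`-th basis
  -- vector to `b`.
  set V : Matrix (Fin N) (Fin N) ℂ := Matrix.of fun k j => e j k with hVdef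
  have hV : V.conjTranspose * V = 1 := by
    ext j k
    have := orthonormal_iff_ite.mp e.orthonormal j k
    rw [PiLp.inner_apply] at this
    simp only [Matrix.mul_apply, Matrix.conjTranspose_apply, hVdef, Matrix.of_apply,
      Matrix.one_apply, ← this]
    exact Finset.sum_congr rfl fun l _ => by simp [mul_comm]
  have hVb : WithLp.toLp 2 (V.mulVec (EuclideanSpace.single i (1 : ℂ)).ofLp) = b := by
    rw [← he]
    ext k
    simp [hVdef, Matrix.mulVec_single]
  have hm : ∀ b : CVec N, Measurable fun h : Fin N → CVec M => invForm h b := fun b =>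
    measurable_invForm measurable_id measurable_const
  conv_rhs => rw [← map_mix_channelLaw hV, Measure.map_map (hm _) (measurable_mix V)]
  congr 1
  ext h
  simp only [Function.comp_apply]
  rw [invForm_mix hV, hVb]

section
open scoped ComplexOrder MatrixOrder Matrix.Norms.L2Operator
/-! ### Projections of Gaussian vectors -/

/-- In an orthonormal basis of `S`, the coordinates of the projection form a map whose adjoint is
the isometric inclusion, so they are again iid Gaussian. -/
lemma map_norm_starProjection_gaussianVec {n m : ℕ} (S : Submodule ℂ (CVec n))
    (hS : Module.finrank ℂ S = m) :
    (gaussianVec n).map (fun x => ‖S.starProjection x‖ ^ 2) =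
      (gaussianVec m).map (fun z => ‖z‖ ^ 2) := by
  have b : OrthonormalBasis (Fin m) ℂ S := (stdOrthonormalBasis ℂ S).reindex (finCongr hS)
  have h := map_gaussianVec_of_norm_adjoint
    (b.repr.toLinearEquiv.toLinearMap ∘ₗ S.orthogonalProjectionOnto.toLinearMap)
    (S.subtype ∘ₗ b.repr.symm.toLinearEquiv.toLinearMap)
    (fun x y => by
      have h1 := b.repr.inner_map_map (S.orthogonalProjectionOnto x) (b.repr.symm y)
      simpa using h1) (fun y => by
      simp [-Submodule.coe_norm, ← Submodule.coe_norm])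
  rw [← h, Measure.map_map (by fun_prop) (LinearMap.continuous_of_finiteDimensional _).measurable]
  congr 1
  ext x
  simp

/-! ### Least squares and the combiner -/

/-- The combination `H c` of the columns of `H`. -/
noncomputable def synth {N M : ℕ} (h : Fin N → CVec M) : CVec N →ₗ[ℂ] CVec M :=
  Fintype.linearCombination ℂ h ∘ₗ (WithLp.linearEquiv 2 ℂ (Fin N → ℂ)).toLinearMap

lemma synth_apply {N M : ℕ} (h : Fin N → CVec M) (c : CVec N) : synth h c = ∑ i, c i • h i := rfl

/-- The vector `Hᴴ v`. -/
noncomputable def analysis {N M : ℕ} (h : Fin N → CVec M) : CVec M →ₗ[ℂ] CVec N :=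
  (WithLp.linearEquiv 2 ℂ (Fin N → ℂ)).symm.toLinearMap ∘ₗ
    LinearMap.pi fun i => (innerₛₗ ℂ (h i))

lemma analysis_apply {N M : ℕ} (h : Fin N → CVec M) (v : CVec M) (i : Fin N) :
    analysis h v i = ⟪h i, v⟫_ℂ := rfl

lemma inner_synth {N M : ℕ} (h : Fin N → CVec M) (c : CVec N) (v : CVec M) :
    ⟪synth h c, v⟫_ℂ = ⟪c, analysis h v⟫_ℂ := by
  simp [synth_apply, PiLp.inner_apply, analysis_apply, mul_comm]

lemma analysis_synth {N M : ℕ} (h : Fin N → CVec M) (c : CVec N) :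
    analysis h (synth h c) = Matrix.toEuclideanLin (Matrix.gram ℂ h) c := by
  ext i
  simp [synth_apply, analysis_apply, Matrix.mulVec, dotProduct,
    mul_comm]

/-- The least squares coefficients `(Hᴴ H)⁻¹ Hᴴ v`. -/
noncomputable def lsq {N M : ℕ} (h : Fin N → CVec M) : CVec M →ₗ[ℂ] CVec N :=
  Matrix.toEuclideanLin (Matrix.gram ℂ h)⁻¹ ∘ₗ analysis h

lemma toEuclideanLin_mul_apply {N : ℕ} (A B : Matrix (Fin N) (Fin N) ℂ) (c : CVec N) :
    Matrix.toEuclideanLin (A * B) c = Matrix.toEuclideanLin A (Matrix.toEuclideanLin B c) := by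
  ext i
  simp [Matrix.mulVec_mulVec]

lemma toEuclideanLin_one_apply {N : ℕ} (c : CVec N) :
    Matrix.toEuclideanLin (1 : Matrix (Fin N) (Fin N) ℂ) c = c := by
  ext i
  simp

lemma isUnit_det_gram {N M : ℕ} {h : Fin N → CVec M} (hh : LinearIndependent ℂ h) :
    IsUnit (Matrix.gram ℂ h).det :=
  isUnit_iff_ne_zero.mpr (Matrix.det_gram_ne_zero_iff_linearIndependent.mpr hh)

lemma analysis_synth_lsq {N M : ℕ} {h : Fin N → CVec M} (hh : LinearIndependent ℂ h)
    (v : CVec M) : analysis h (synth h (lsq h v)) = analysis h v := by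
  rw [analysis_synth, lsq, LinearMap.comp_apply, ← toEuclideanLin_mul_apply,
    Matrix.mul_nonsing_inv _ (isUnit_det_gram hh), toEuclideanLin_one_apply]

/-- The normal equations `analysis_synth_lsq` say that the residual is orthogonal to every column.
-/
lemma synth_lsq {N M : ℕ} {h : Fin N → CVec M} (hh : LinearIndependent ℂ h) (v : CVec M) :
    synth h (lsq h v) = proj h v := by
  rw [proj]
  symm
  refine Submodule.eq_starProjection_of_mem_of_inner_eq_zero ?_ fun w hw => ?_
  · rw [synth_apply]
    exact Submodule.sum_mem _ fun i _ =>
      Submodule.smul_mem _ _ (Submodule.subset_span (Set.mem_range_self i))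
  · obtain ⟨c, rfl⟩ := (Submodule.mem_span_range_iff_exists_fun ℂ).mp hw
    have h1 := inner_synth h (WithLp.toLp 2 c) (v - synth h (lsq h v))
    rw [map_sub, analysis_synth_lsq hh, sub_self, inner_zero_right, synth_apply] at h1
    rw [← inner_conj_symm]
    simp only at h1
    rw [h1, map_zero]

/-- The squared norm of the effective channel for a channel matrix of full column rank. -/
noncomputable def gain {N M : ℕ} (h : Fin N → CVec M) (v : CVec M) : ℝ :=
  ‖synth h (lsq h v)‖ ^ 2 / ‖lsq h v‖ ^ 2

lemma conjTranspose_channelMatrix_mul {N M : ℕ} (h : Fin N → CVec M) :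
    (channelMatrix h).conjTranspose * channelMatrix h = Matrix.gram ℂ h := by
  ext i j
  simp [channelMatrix, Matrix.mul_apply, PiLp.inner_apply, mul_comm]

lemma coeff_eq {N M : ℕ} (h : Fin N → CVec M) (v : CVec M) :
    coeff h v = lsq h (normalized (proj h v)) := by
  rw [coeff, conjTranspose_channelMatrix_mul, ← Matrix.mulVec_mulVec]
  ext i
  simp only [lsq, LinearMap.comp_apply, Matrix.toLpLin_apply]
  congr 2
  ext j
  simp [analysis_apply, channelMatrix, Matrix.mulVec, dotProduct, PiLp.inner_apply, mul_comm]

lemma effChannel_eq {N M : ℕ} (h : Fin N → CVec M) (v : CVec M) :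
    effChannel h v = synth h (weights h v) := by
  ext j
  simp [effChannel, synth_apply, channelMatrix, Matrix.mulVec, dotProduct, mul_comm]

lemma norm_effChannel_sq {N M : ℕ} {h : Fin N → CVec M} (hh : LinearIndependent ℂ h)
    {v : CVec M} (hv : proj h v ≠ 0) : ‖effChannel h v‖ ^ 2 = gain h v := by
  have h1 : lsq h (proj h v) = lsq h v := by
    rw [← synth_lsq hh, lsq, LinearMap.comp_apply, ← lsq, analysis_synth_lsq hh]; rfl
  have h2 : coeff h v = ((‖proj h v‖⁻¹ : ℝ) : ℂ) • lsq h v := by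
    rw [coeff_eq, normalized, map_smul, h1]
  have h3 : lsq h v ≠ 0 := fun h0 => hv (by rw [← synth_lsq hh, h0, map_zero])
  have h4 : ‖proj h v‖ ≠ 0 := norm_ne_zero_iff.mpr hv
  have h5 : ‖lsq h v‖ ≠ 0 := norm_ne_zero_iff.mpr h3
  rw [effChannel_eq, weights, normalized, h2, map_smul, map_smul, synth_lsq hh, norm_smul,
    norm_smul, norm_smul, gain, synth_lsq hh]
  simp only [Complex.norm_real, norm_inv, norm_norm, norm_mul]
  field_simp

lemma invForm_eq_re_inner {N M : ℕ} (h : Fin N → CVec M) (b : CVec N) :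
    invForm h b = (⟪b, Matrix.toEuclideanLin (Matrix.gram ℂ h)⁻¹ b⟫_ℂ).re := by
  rw [invForm, EuclideanSpace.inner_eq_star_dotProduct, dotProduct_comm]
  rfl

/-- Polar decomposition `H = J S` with `S` positive and `J` isometric, in terms of the projection
onto the column span and the least squares coefficients. -/
lemma exists_polar {N M : ℕ} {h : Fin N → CVec M} (hh : LinearIndependent ℂ h) :
    ∃ (J : CVec N →ₗ[ℂ] CVec M) (J' : CVec M →ₗ[ℂ] CVec N),
      (∀ c v, ⟪J c, v⟫_ℂ = ⟪c, J' v⟫_ℂ) ∧ (∀ c, J' (J c) = c) ∧ (∀ v, J (J' v) = proj h v) ∧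
      ∀ v, ‖lsq h v‖ ^ 2 = invForm h (J' v) := by
  set W := Matrix.gram ℂ h with hW
  have hpos : W.PosDef := Matrix.posDef_gram_of_linearIndependent hh
  -- With `S = √W`, take `J = H S⁻¹` and `J' = S⁻¹ Hᴴ`. The last property holds because `W⁻¹ Hᴴ v =
  -- S⁻¹ (J' v)` and `S⁻¹` is Hermitian with square `W⁻¹`.
  obtain ⟨S, hS, hSS⟩ : ∃ S : Matrix (Fin N) (Fin N) ℂ, S.IsHermitian ∧ S * S = W :=
    ⟨CFC.sqrt W, (Matrix.nonneg_iff_posSemidef.mp (CFC.sqrt_nonneg W)).1,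
      CFC.sqrt_mul_sqrt_self W hpos.posSemidef.nonneg⟩
  have hdet : IsUnit S.det := by
    have := isUnit_det_gram hh
    rw [← hW, ← hSS, Matrix.det_mul] at this
    exact isUnit_of_mul_isUnit_left this
  have hinv : W⁻¹ = S⁻¹ * S⁻¹ := by rw [← hSS, Matrix.mul_inv_rev]
  have hSi : S⁻¹.IsHermitian := hS.inv
  have hadj : ∀ x y : CVec N, ⟪Matrix.toEuclideanLin S⁻¹ x, y⟫_ℂ =
      ⟪x, Matrix.toEuclideanLin S⁻¹ y⟫_ℂ := Matrix.isSymmetric_toEuclideanLin_iff.mpr hSi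
  refine ⟨synth h ∘ₗ Matrix.toEuclideanLin S⁻¹, Matrix.toEuclideanLin S⁻¹ ∘ₗ analysis h,
    fun c v => ?_, fun c => ?_, fun v => ?_, fun v => ?_⟩
  · simp only [LinearMap.comp_apply]
    rw [inner_synth, hadj]
  · simp only [LinearMap.comp_apply]
    rw [analysis_synth, ← hW, ← hSS, ← toEuclideanLin_mul_apply, ← toEuclideanLin_mul_apply,
      ← mul_assoc, Matrix.nonsing_inv_mul _ hdet, one_mul, Matrix.mul_nonsing_inv _ hdet,
      toEuclideanLin_one_apply]
  · simp only [LinearMap.comp_apply]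
    rw [← toEuclideanLin_mul_apply, ← hinv, ← synth_lsq hh, lsq, LinearMap.comp_apply]
  · simp only [LinearMap.comp_apply]
    rw [invForm_eq_re_inner, ← hW, lsq, LinearMap.comp_apply, ← hW, hinv, toEuclideanLin_mul_apply,
      toEuclideanLin_mul_apply, ← hadj, inner_self_eq_norm_sq_to_K]
    norm_cast

lemma invForm_smul {N M : ℕ} (h : Fin N → CVec M) (r : ℝ) (b : CVec N) :
    invForm h ((r : ℂ) • b) = r ^ 2 * invForm h b := by
  rw [invForm_eq_re_inner, invForm_eq_re_inner, map_smul, inner_smul_left, inner_smul_right]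
  simp [sq, mul_assoc]

/-- For the first basis vector, `bᴴ (Hᴴ H)⁻¹ b` is the inverse squared distance of the first column
from the span of the others. -/
lemma inv_invForm_single {N M : ℕ} {x : CVec M} {t : Fin N → CVec M}
    (hh : LinearIndependent ℂ (Fin.cons x t : Fin (N + 1) → CVec M)) :
    (invForm (Fin.cons x t : Fin (N + 1) → CVec M) (EuclideanSpace.single 0 1))⁻¹ =
      ‖(Submodule.span ℂ (Set.range t))ᗮ.starProjection x‖ ^ 2 := by
  set h : Fin (N + 1) → CVec M := Fin.cons x t with hdef
  set e : CVec (N + 1) := EuclideanSpace.single 0 1 with he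
  set y : CVec (N + 1) := Matrix.toEuclideanLin (Matrix.gram ℂ h)⁻¹ e with hy
  set T := (Submodule.span ℂ (Set.range t))ᗮ with hT
  -- Since `Hᴴ q = e`, the vector `q` is orthogonal to all columns but the first, so it is `y 0`
  -- times the projection of `x` on `T`. Also `‖q‖² = y 0` is the value of the form; comparing norms
  -- gives the claim.
  set q := synth h y with hq
  have hq1 : analysis h q = e := by
    rw [hq, analysis_synth, hy, ← toEuclideanLin_mul_apply,
      Matrix.mul_nonsing_inv _ (isUnit_det_gram hh), toEuclideanLin_one_apply]
  have hq2 : q ∈ T := by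
    rw [hT, Submodule.mem_orthogonal]
    intro u hu
    obtain ⟨c, rfl⟩ := (Submodule.mem_span_range_iff_exists_fun ℂ).mp hu
    rw [sum_inner]
    refine Finset.sum_eq_zero fun i _ => ?_
    have h1 : analysis h q i.succ = 0 := by rw [hq1]; simp [he]
    rw [analysis_apply] at h1
    simp only [hdef, Fin.cons_succ] at h1
    rw [inner_smul_left, h1, mul_zero]
  have hq3 : q = y 0 • T.starProjection x := by
    have h1 : T.starProjection q = q := Submodule.starProjection_eq_self_iff.mpr hq2
    have h2 : q = y 0 • x + ∑ i : Fin N, y i.succ • t i := by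
      rw [hq, synth_apply, Fin.sum_univ_succ]; simp [hdef]
    have h3 : T.starProjection (∑ i : Fin N, y i.succ • t i) = 0 := by
      rw [Submodule.starProjection_apply_eq_zero_iff]
      exact Submodule.le_orthogonal_orthogonal _ (Submodule.sum_mem _ fun i _ =>
        Submodule.smul_mem _ _ (Submodule.subset_span (Set.mem_range_self i)))
    rw [← h1, h2, map_add, h3, add_zero, map_smul]
  have hey : ⟪e, y⟫_ℂ = y 0 :=
    (EuclideanSpace.inner_single_left 0 1 y).trans (by simp)
  have hxq : (‖q‖ ^ 2 : ℝ) = y 0 := by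
    have h1 := inner_synth h y q
    rw [hq1, ← hq, inner_self_eq_norm_sq_to_K] at h1
    have h2 : y 0 = starRingEnd ℂ ⟪y, e⟫_ℂ := by rw [inner_conj_symm, hey]
    rw [h2, ← h1]
    simp
  have hform : invForm h e = ‖q‖ ^ 2 := by
    rw [invForm_eq_re_inner, ← hy]
    rw [hey, ← hxq, Complex.ofReal_re]
  have hq0 : q ≠ 0 := by
    intro h0
    have h1 : e 0 = 0 := by rw [← hq1, h0, map_zero]; rfl
    simp [he] at h1
  rw [hform]
  have h4 : ‖q‖ ^ 2 = (‖q‖ ^ 2) ^ 2 * ‖T.starProjection x‖ ^ 2 := by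
    conv_lhs => rw [hq3, norm_smul, mul_pow, ← hxq, Complex.norm_real, Real.norm_eq_abs, sq_abs]
  have h5 : ‖q‖ ^ 2 ≠ 0 := by simpa using hq0
  field_simp
  nlinarith [mul_left_cancel₀ h5 (show ‖q‖ ^ 2 * 1 = ‖q‖ ^ 2 * (‖q‖ ^ 2 * ‖T.starProjection x‖ ^ 2) by
    linarith)]

end

/-! ### Selection of the quantization vector -/

/-- The squared norm of the projection on the column span, for a channel matrix of full column
rank. -/
noncomputable def score {N M : ℕ} (h : Fin N → CVec M) (v : CVec M) : ℝ :=
  ‖synth h (lsq h v)‖ ^ 2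

/-- `score` goes through the inverse Gram matrix rather than a projection on a varying subspace,
which makes it jointly measurable in channel and codeword. -/
lemma score_eq {N M : ℕ} {h : Fin N → CVec M} (hh : LinearIndependent ℂ h) (v : CVec M) :
    score h v = ‖proj h v‖ ^ 2 := by
  rw [score, synth_lsq hh]

/-- `l` is the unique maximizer of the score. -/
def IsStrictMax {N M L : ℕ} (h : Fin N → CVec M) (w : Fin L → CVec M) (l : Fin L) : Prop :=
  ∀ l', l' ≠ l → score h (w l') < score h (w l)

open scoped Classical in
/-- The value `f h wₗ` at the unique maximizer `l` of the score, and `0` if there is none. -/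
noncomputable def atMax {N M L : ℕ} {E : Type*} [AddCommMonoid E]
    (f : (Fin N → CVec M) → CVec M → E) (h : Fin N → CVec M) (w : Fin L → CVec M) : E :=
  ∑ l, if IsStrictMax h w l then f h (w l) else 0

lemma atMax_eq {N M L : ℕ} {E : Type*} [AddCommMonoid E]
    (f : (Fin N → CVec M) → CVec M → E) {h : Fin N → CVec M} {w : Fin L → CVec M} {l : Fin L}
    (hl : IsStrictMax h w l) : atMax f h w = f h (w l) := by
  rw [atMax, Finset.sum_eq_single l, if_pos hl]
  · intro l' _ hne
    exact if_neg fun hl' => lt_asymm (hl l' hne) (hl' l hne.symm)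
  · simp

lemma measurable_lsq {N M : ℕ} :
    Measurable (fun p : (Fin N → CVec M) × CVec M => lsq p.1 p.2) := by
  have h1 : ∀ i j : Fin N, Measurable fun p : (Fin N → CVec M) × CVec M =>
      (Matrix.gram ℂ p.1)⁻¹ i j := fun i j => (measurable_gram_inv_apply i j).comp measurable_fst
  have h2 : ∀ i : Fin N, Measurable fun p : (Fin N → CVec M) × CVec M => ⟪p.1 i, p.2⟫_ℂ :=
    fun i => Continuous.measurable (by fun_prop)
  refine measurable_toLp_pi.comp (measurable_pi_lambda _ fun i => ?_)
  exact Finset.measurable_sum Finset.univ fun j _ => (h1 i j).mul (h2 j)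

lemma measurable_synth {N M : ℕ} :
    Measurable (fun p : (Fin N → CVec M) × CVec N => synth p.1 p.2) := by
  simp only [synth_apply]
  exact Continuous.measurable (by fun_prop)

lemma measurable_score {N M : ℕ} {α : Type*} [MeasurableSpace α] {f : α → Fin N → CVec M}
    {g : α → CVec M} (hf : Measurable f) (hg : Measurable g) :
    Measurable fun x => score (f x) (g x) := by
  have h1 := measurable_lsq.comp (hf.prodMk hg)
  have h2 := measurable_synth.comp (hf.prodMk h1)
  exact h2.norm.pow_const 2

lemma measurable_gain {N M : ℕ} {α : Type*} [MeasurableSpace α] {f : α → Fin N → CVec M}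
    {g : α → CVec M} (hf : Measurable f) (hg : Measurable g) :
    Measurable fun x => gain (f x) (g x) := by
  have h1 := measurable_lsq.comp (hf.prodMk hg)
  exact (measurable_score hf hg).div (h1.norm.pow_const 2)

lemma measurableSet_isStrictMax {N M L : ℕ} {α : Type*} [MeasurableSpace α]
    {f : α → Fin N → CVec M} {g : α → Fin L → CVec M} (hf : Measurable f) (hg : Measurable g)
    (l : Fin L) : MeasurableSet {x | IsStrictMax (f x) (g x) l} := by
  have hgl : ∀ l, Measurable fun x => g x l := fun l => (measurable_pi_apply l).comp hg
  have : {x | IsStrictMax (f x) (g x) l} =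
      ⋂ l', ⋂ (_ : l' ≠ l), {x | score (f x) (g x l') < score (f x) (g x l)} := by
    ext x; simp [IsStrictMax]
  rw [this]
  exact MeasurableSet.iInter fun l' => MeasurableSet.iInter fun _ =>
    measurableSet_lt (measurable_score hf (hgl l')) (measurable_score hf (hgl l))

lemma measurable_atMax {N M L : ℕ} {E : Type*} [AddCommMonoid E] [MeasurableSpace E]
    [MeasurableAdd₂ E] {F : (Fin N → CVec M) → CVec M → E} {α : Type*} [MeasurableSpace α]
    {f : α → Fin N → CVec M} {g : α → Fin L → CVec M} (hf : Measurable f) (hg : Measurable g)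
    (hF : ∀ l, Measurable fun x => F (f x) (g x l)) :
    Measurable (fun x => atMax F (f x) (g x)) :=
  Finset.measurable_sum _ fun l _ =>
    Measurable.ite (measurableSet_isStrictMax hf hg l) (hF l) measurable_const

/-- The law of `L` independent isotropic unit vectors in `ℂᴹ`. -/
noncomputable def codebookLaw (L M : ℕ) : Measure (Fin L → CVec M) :=
  Measure.pi fun _ => sphereLaw M

instance isProbabilityMeasure_codebookLaw (L M : ℕ) :
    IsProbabilityMeasure (codebookLaw L M) := by
  unfold codebookLaw; infer_instance

lemma measurePreserving_eval_codebookLaw {L M : ℕ} (l : Fin L) :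
    MeasurePreserving (fun w => w l) (codebookLaw L M) (sphereLaw M) :=
  measurePreserving_eval (fun _ : Fin L => sphereLaw M) l

lemma measurePreserving_eval_pair_codebookLaw {L M : ℕ} {l l' : Fin L} (hl : l ≠ l') :
    MeasurePreserving (fun w => (w l, w l')) (codebookLaw L M)
      ((sphereLaw M).prod (sphereLaw M)) := by
  refine ⟨(measurable_pi_apply l).prodMk (measurable_pi_apply l'), ?_⟩
  have h := (iIndepFun_pi (μ := fun _ : Fin L => sphereLaw M) (X := fun _ x => x)
    (fun _ => aemeasurable_id)).indepFun hl
  rw [indepFun_iff_map_prod_eq_prod_map_map (measurable_pi_apply l).aemeasurable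
    (measurable_pi_apply l').aemeasurable] at h
  refine h.trans ?_
  congr 1 <;> exact (measurePreserving_eval_codebookLaw _).map_eq

/-! ### Selection and combining for a fixed channel matrix -/

section fixedChannel

variable {N M : ℕ} {h : Fin N → CVec M}

/-- The column span is proper because `N < M`; for `N = M` every unit vector would have score 1 and
ties would be certain. -/
lemma ae_score_ne (hN : 1 ≤ N) (hNM : N < M) (hh : LinearIndependent ℂ h) (c : ℝ) :
    ∀ᵐ v ∂sphereLaw M, score h v ≠ c := by
  have hbot : Submodule.span ℂ (Set.range h) ≠ ⊥ := by
    intro h0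
    rw [Submodule.span_eq_bot] at h0
    exact hh.ne_zero ⟨0, hN⟩ (h0 _ (Set.mem_range_self _))
  filter_upwards [ae_sphereLaw_norm_starProjection_ne _ (span_range_ne_top hNM h) hbot c] with v hv
  rwa [score_eq hh, proj]

/-- With one codeword fixed, an independent one attains the same score with probability zero; there
are finitely many pairs. -/
lemma ae_exists_isStrictMax (hN : 1 ≤ N) (hNM : N < M) (hh : LinearIndependent ℂ h)
    {L : ℕ} (hL : 0 < L) :
    ∀ᵐ w ∂codebookLaw L M, ∃ l, IsStrictMax h w l ∧ score h (w l) ≠ 0 := by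
  have h1 : ∀ᵐ w ∂codebookLaw L M, ∀ l, score h (w l) ≠ 0 := by
    rw [ae_all_iff]
    intro l
    exact (measurePreserving_eval_codebookLaw l).quasiMeasurePreserving.ae
      (ae_score_ne hN hNM hh 0)
  have h2 : ∀ᵐ w ∂codebookLaw L M, ∀ l l', l ≠ l' → score h (w l') ≠ score h (w l) := by
    simp_rw [ae_all_iff]
    intro l l' hl
    have : ∀ᵐ p ∂(sphereLaw M).prod (sphereLaw M), p ∈ {p : CVec M × CVec M |
        score h p.2 ≠ score h p.1} := by
      have hm : MeasurableSet {p : CVec M × CVec M | score h p.2 ≠ score h p.1} :=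
        (measurableSet_eq_fun (measurable_score measurable_const measurable_snd)
        (measurable_score measurable_const measurable_fst)).compl
      rw [Measure.ae_prod_mem_iff_ae_ae_mem hm]
      exact Filter.Eventually.of_forall fun v => ae_score_ne hN hNM hh (score h v)
    exact (measurePreserving_eval_pair_codebookLaw hl).quasiMeasurePreserving.ae this
  have : Nonempty (Fin L) := ⟨⟨0, hL⟩⟩
  filter_upwards [h1, h2] with w hw1 hw2
  obtain ⟨l, hl⟩ := Finite.exists_max fun l => score h (w l)
  exact ⟨l, fun l' hne => lt_of_le_of_ne (hl l') (hw2 l l' hne.symm), hw1 l⟩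

/-- Given an isometry `J` with adjoint `J'`, a unitary map of the domain extends to a unitary map
of the codomain that fixes the orthogonal complement of the range of `J`. -/
lemma exists_linearIsometryEquiv_intertwining {J : CVec N →ₗ[ℂ] CVec M}
    {J' : CVec M →ₗ[ℂ] CVec N} (hJ : ∀ c v, ⟪J c, v⟫_ℂ = ⟪c, J' v⟫_ℂ) (hJJ : ∀ c, J' (J c) = c)
    (V : CVec N ≃ₗᵢ[ℂ] CVec N) :
    ∃ U : CVec M ≃ₗᵢ[ℂ] CVec M, ∀ v, J' (U v) = V (J' v) := by
  -- `f` is `J V J'` on the range of `J` and the identity on its orthogonal complement; Pythagoras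
  -- makes it isometric.
  let f : CVec M →ₗ[ℂ] CVec M :=
    LinearMap.id - J ∘ₗ J' + J ∘ₗ V.toLinearEquiv.toLinearMap ∘ₗ J'
  have hf : ∀ v, f v = (v - J (J' v)) + J (V (J' v)) := fun v => rfl
  have hJn : ∀ c, ‖J c‖ = ‖c‖ := by
    intro c
    have h1 := hJ c (J c)
    rw [hJJ, inner_self_eq_norm_sq_to_K, inner_self_eq_norm_sq_to_K] at h1
    have h2 : ‖J c‖ ^ 2 = ‖c‖ ^ 2 := by exact_mod_cast h1
    exact (sq_eq_sq₀ (norm_nonneg _) (norm_nonneg _)).mp h2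
  have hpyth : ∀ v c, ‖(v - J (J' v)) + J c‖ ^ 2 = ‖v - J (J' v)‖ ^ 2 + ‖c‖ ^ 2 := by
    intro v c
    have h0 : ⟪J c, v - J (J' v)⟫_ℂ = 0 := by rw [hJ, map_sub, hJJ, sub_self, inner_zero_right]
    have h1 : ⟪v - J (J' v), J c⟫_ℂ = 0 := by rw [← inner_conj_symm, h0, map_zero]
    have := norm_add_sq_eq_norm_sq_add_norm_sq_of_inner_eq_zero _ _ h1
    rw [hJn] at this
    simpa [sq] using this
  have hnorm : ∀ v, ‖f v‖ = ‖v‖ := by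
    intro v
    have h1 := hpyth v (V (J' v))
    have h2 := hpyth v (J' v)
    rw [sub_add_cancel] at h2
    rw [V.norm_map, ← h2, ← hf] at h1
    exact (sq_eq_sq₀ (norm_nonneg _) (norm_nonneg _)).mp h1
  refine ⟨LinearIsometry.toLinearIsometryEquiv ⟨f, hnorm⟩ rfl, fun v => ?_⟩
  have : (LinearIsometry.toLinearIsometryEquiv ⟨f, hnorm⟩ rfl) v = f v := rfl
  rw [this, hf, map_add, map_sub, hJJ, hJJ, sub_self, zero_add]

/-- For a fixed channel matrix `H` of full column rank, the squared norm of the effective channel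
is distributed as `(bᴴ (Hᴴ H)⁻¹ b)⁻¹` with `b` isotropic. -/
lemma map_atMax_gain_codebookLaw (hN : 1 ≤ N) (hNM : N < M) (hh : LinearIndependent ℂ h)
    {L : ℕ} (hL : 0 < L) :
    (codebookLaw L M).map (fun w => atMax gain h w) =
      (sphereLaw N).map (fun b => (invForm h b)⁻¹) := by
  obtain ⟨J, J', hJ, hJJ, hproj, hlsq⟩ := exists_polar hh
  have hscore : ∀ v, score h v = ‖J' v‖ ^ 2 := by
    intro v
    have h1 := hJ (J' v) (J (J' v))
    rw [hJJ, inner_self_eq_norm_sq_to_K, inner_self_eq_norm_sq_to_K, hproj] at h1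
    rw [score_eq hh]
    exact_mod_cast h1
  set β : (Fin L → CVec M) → CVec N := fun w => atMax (fun _ v => normalized (J' v)) h w with hβ
  have hJ'm : Measurable J' := J'.continuous_of_finiteDimensional.measurable
  have hβm : Measurable β :=
    measurable_atMax measurable_const measurable_id fun l =>
      (measurable_normalized.comp hJ'm).comp (measurable_pi_apply l)
  have hae := ae_exists_isStrictMax hN hNM hh hL
  have hiso : IsIsotropic ((codebookLaw L M).map β) := by
    refine ⟨Measure.isProbabilityMeasure_map hβm.aemeasurable, ?_, fun V => ?_⟩
    · rw [ae_map_iff hβm.aemeasurable (measurableSet_eq_fun (by fun_prop) (by fun_prop))]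
      filter_upwards [hae] with w ⟨l, hl, hl0⟩
      rw [hβ]
      simp only
      rw [atMax_eq _ hl]
      refine norm_normalized fun h0 => hl0 ?_
      rw [hscore, h0]; simp
    -- Applying `U` to the whole codebook preserves its law and all scores, hence the selected
    -- index, and turns `β` into `V β`.
    · obtain ⟨U, hU⟩ := exists_linearIsometryEquiv_intertwining hJ hJJ V
      have hUm : Measurable U := by fun_prop
      have hUpi : (codebookLaw L M).map (fun w l => U (w l)) = codebookLaw L M :=
        (measurePreserving_pi (fun _ : Fin L => sphereLaw M) (fun _ : Fin L => sphereLaw M)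
          (f := fun _ => U) fun _ => ⟨hUm, (isIsotropic_sphereLaw (by omega)).invariant U⟩).map_eq
      have hVm : Measurable V := by fun_prop
      have hUm' : Measurable (fun (w : Fin L → CVec M) l => U (w l)) := by fun_prop
      rw [Measure.map_map hVm hβm]
      conv_rhs => rw [← hUpi, Measure.map_map hβm hUm']
      refine Measure.map_congr ?_
      filter_upwards [hae] with w ⟨l, hl, hl0⟩
      have hl' : IsStrictMax h (fun l => U (w l)) l := by
        intro l' hne
        have := hl l' hne
        simpa only [hscore, hU, V.norm_map] using this
      simp only [Function.comp_apply, hβ]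
      rw [atMax_eq _ hl, atMax_eq _ hl', map_normalized, hU]
  rw [← hiso.eq (isIsotropic_sphereLaw hN), Measure.map_map _ hβm]
  · refine Measure.map_congr ?_
    filter_upwards [hae] with w ⟨l, hl, hl0⟩
    simp only [Function.comp_apply, hβ]
    -- With `b = J' (w l)`, the gain is `‖b‖²` over the form at `b`, which is the inverse of the
    -- form at `b / ‖b‖`.
    rw [atMax_eq _ hl, atMax_eq _ hl, normalized, invForm_smul, gain, ← score, hscore, hlsq]
    rw [hscore] at hl0
    simp [div_eq_mul_inv, mul_comm]
  · exact (measurable_invForm measurable_const measurable_id).inv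

end fixedChannel

/-! ### The law of the effective channel -/

/-- Conditioning on the last `N` of the `N + 1` columns, which span a space with orthogonal
complement of dimension `M - N`, leaves the first column Gaussian. -/
lemma lintegral_invForm_single {N M : ℕ} (hNM : N < M) {f : ℝ → ℝ≥0∞} (hf : Measurable f) :
    ∫⁻ h, f (invForm h (EuclideanSpace.single 0 1))⁻¹ ∂channelLaw (N + 1) M =
      ∫⁻ z, f (‖z‖ ^ 2) ∂gaussianVec (M - N) := by
  have hm : Measurable fun h : Fin (N + 1) → CVec M =>
      f (invForm h (EuclideanSpace.single 0 1))⁻¹ :=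
    hf.comp (measurable_invForm measurable_id measurable_const).inv
  have hLI := ae_linearIndependent_channelLaw (N := N + 1) (M := M) hNM
  have hli : ∀ᵐ t ∂channelLaw N M, ∀ᵐ x ∂gaussianVec M,
      LinearIndependent ℂ (Fin.cons x t : Fin (N + 1) → CVec M) := by
    have hmeas : MeasurableSet {p : CVec M × (Fin N → CVec M) |
        LinearIndependent ℂ (Fin.cons p.1 p.2 : Fin (N + 1) → CVec M)} :=
      measurable_cons measurableSet_linearIndependent
    rw [← map_cons_channelLaw, ae_map_iff measurable_cons.aemeasurable
      measurableSet_linearIndependent] at hLI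
    exact (Measure.ae_ae_comm hmeas).1 (Measure.ae_ae_of_ae_prod hLI)
  have hmc : Measurable fun p : CVec M × (Fin N → CVec M) =>
      f (invForm (Fin.cons p.1 p.2 : Fin (N + 1) → CVec M) (EuclideanSpace.single 0 1))⁻¹ :=
    hm.comp measurable_cons
  rw [← map_cons_channelLaw, lintegral_map hm measurable_cons, lintegral_prod_symm' _ hmc]
  have hinner : ∀ᵐ t ∂channelLaw N M,
      ∫⁻ x, f (invForm (Fin.cons x t : Fin (N + 1) → CVec M) (EuclideanSpace.single 0 1))⁻¹
        ∂gaussianVec M = ∫⁻ z, f (‖z‖ ^ 2) ∂gaussianVec (M - N) := by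
    filter_upwards [hli, ae_linearIndependent_channelLaw (N := N) (M := M) (by omega)] with t ht hti
    have hfin : Module.finrank ℂ (Submodule.span ℂ (Set.range t))ᗮ = M - N := by
      have h1 := Submodule.finrank_add_finrank_orthogonal (Submodule.span ℂ (Set.range t))
      rw [finrank_span_eq_card hti, Fintype.card_fin, finrank_euclideanSpace_fin] at h1
      omega
    have h2 : ∀ᵐ x ∂gaussianVec M,
        f (invForm (Fin.cons x t : Fin (N + 1) → CVec M) (EuclideanSpace.single 0 1))⁻¹ =
          f (‖(Submodule.span ℂ (Set.range t))ᗮ.starProjection x‖ ^ 2) := by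
      filter_upwards [ht] with x hx
      rw [inv_invForm_single hx]
    rw [lintegral_congr_ae h2,
      ← lintegral_map (μ := gaussianVec M)
        (g := fun x => ‖(Submodule.span ℂ (Set.range t))ᗮ.starProjection x‖ ^ 2) hf (by fun_prop),
      map_norm_starProjection_gaussianVec _ hfin, lintegral_map hf (by fun_prop)]
  rw [lintegral_congr_ae hinner]
  simp

/-- Exchanging the integrals fixes the unit vector `b`, and unitary invariance of the channel
replaces it by a basis vector. -/
lemma lintegral_invForm_sphereLaw {N M : ℕ} (hN : 1 ≤ N) (hNM : N ≤ M) {f : ℝ → ℝ≥0∞}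
    (hf : Measurable f) :
    ∫⁻ h, ∫⁻ b, f (invForm h b)⁻¹ ∂sphereLaw N ∂channelLaw N M =
      ∫⁻ z, f (‖z‖ ^ 2) ∂gaussianVec (M - N + 1) := by
  obtain ⟨n, rfl⟩ : ∃ n, N = n + 1 := ⟨N - 1, by omega⟩
  have hm : Measurable fun p : (Fin (n + 1) → CVec M) × CVec (n + 1) => f (invForm p.1 p.2)⁻¹ :=
    hf.comp (measurable_invForm measurable_fst measurable_snd).inv
  rw [lintegral_lintegral_swap hm.aemeasurable]
  have h1 : ∀ᵐ b ∂sphereLaw (n + 1), ∫⁻ h, f (invForm h b)⁻¹ ∂channelLaw (n + 1) M =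
      ∫⁻ z, f (‖z‖ ^ 2) ∂gaussianVec (M - (n + 1) + 1) := by
    filter_upwards [(isIsotropic_sphereLaw hN).unit_norm] with b hb
    have hmb : ∀ b : CVec (n + 1), Measurable fun h : Fin (n + 1) → CVec M => invForm h b :=
      fun b => measurable_invForm measurable_id measurable_const
    have hfi : Measurable fun x : ℝ => f x⁻¹ := hf.comp measurable_inv
    rw [← lintegral_map hfi (hmb b), map_invForm_channelLaw 0 hb, lintegral_map hfi (hmb _),
      lintegral_invForm_single hNM hf, show M - (n + 1) + 1 = M - n by omega]
  rw [lintegral_congr_ae h1]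
  simp

lemma measurable_atMax_gain {N M L : ℕ} :
    Measurable (fun p : (Fin N → CVec M) × (Fin L → CVec M) => atMax gain p.1 p.2) :=
  measurable_atMax measurable_fst measurable_snd fun l =>
    measurable_gain measurable_fst ((measurable_pi_apply l).comp measurable_snd)

lemma map_atMax_gain {N M L : ℕ} (hN : 1 ≤ N) (hNM : N < M) (hL : 0 < L) :
    ((channelLaw N M).prod (codebookLaw L M)).map (fun p => atMax gain p.1 p.2) =
      (gaussianVec (M - N + 1)).map (fun z => ‖z‖ ^ 2) := by
  refine Measure.ext_of_lintegral _ fun f hf => ?_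
  have hm : Measurable fun p : (Fin N → CVec M) × (Fin L → CVec M) => f (atMax gain p.1 p.2) :=
    hf.comp measurable_atMax_gain
  rw [lintegral_map hf measurable_atMax_gain, lintegral_map hf (by fun_prop),
    lintegral_prod _ hm.aemeasurable,
    ← lintegral_invForm_sphereLaw hN hNM.le hf]
  refine lintegral_congr_ae ?_
  filter_upwards [ae_linearIndependent_channelLaw hNM.le] with h hh
  have h1 : Measurable fun w : Fin L → CVec M => atMax gain h w :=
    measurable_atMax measurable_const measurable_id fun l =>
      measurable_gain measurable_const (measurable_pi_apply l)
  have h2 : Measurable fun b : CVec N => (invForm h b)⁻¹ :=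
    (measurable_invForm measurable_const measurable_id).inv
  rw [← lintegral_map hf h1, map_atMax_gain_codebookLaw hN hNM hh hL, lintegral_map hf h2]

/-- The channel matrix and the codebook of one mobile are independent, with the expected laws. -/
lemma IsDownlink.hasLaw_channel_codebook {Ω : Type*} [MeasurableSpace Ω] {μ : Measure Ω}
    [IsProbabilityMeasure μ] {K M N B : ℕ} {h : Fin K → Fin N → Ω → CVec M}
    {w : Fin K → Fin (2 ^ B) → Ω → CVec M} (hsys : IsDownlink μ h w) (hM : 1 ≤ M) (k : Fin K) :
    HasLaw (fun ω => ((fun i => h k i ω), (fun l => w k l ω)))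
      ((channelLaw N M).prod (codebookLaw (2 ^ B) M)) μ := by
  have hw : ∀ l, μ.map (w k l) = sphereLaw M := fun l =>
    (hsys.codeword_isotropic k l).eq (isIsotropic_sphereLaw hM)
  -- Independence is restricted to the vectors of mobile `k` through an injection of index sets.
  have hind := hsys.indep.precomp
    (g := Sum.map (fun i : Fin N => (k, i)) (fun l : Fin (2 ^ B) => (k, l)))
    (Sum.map_injective.mpr ⟨Prod.mk_right_injective k, Prod.mk_right_injective k⟩)
  set X : Fin N ⊕ Fin (2 ^ B) → Ω → CVec M := Sum.elim (h k) (w k) with hX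
  have hind : iIndepFun X μ := by
    convert hind using 1
    ext (i | l) <;> rfl
  have hXm : ∀ i, AEMeasurable (X i) μ := by
    rintro (i | l)
    · exact (hsys.channel_law k i).aemeasurable
    · exact hsys.codeword_aemeasurable k l
  have hlaw : ∀ i, μ.map (X i) = Sum.elim (fun _ => gaussianVec M) (fun _ => sphereLaw M) i := by
    rintro (i | l)
    · exact (hsys.channel_law k i).map_eq
    · exact hw l
  have hpi := (iIndepFun_iff_map_fun_eq_pi_map hXm).mp hind
  simp_rw [hlaw] at hpi
  have : ∀ i : Fin N ⊕ Fin (2 ^ B), SigmaFinite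
      (Sum.elim (fun _ => gaussianVec M) (fun _ => sphereLaw M) i : Measure (CVec M)) := by
    rintro (i | l) <;> (simp only [Sum.elim_inl, Sum.elim_inr]; infer_instance)
  have hsplit := measurePreserving_sumPiEquivProdPi (ι := Fin N) (ι' := Fin (2 ^ B))
    (X := fun _ => CVec M)
    (fun i => (Sum.elim (fun _ => gaussianVec M) (fun _ => sphereLaw M) i : Measure (CVec M)))
  have hXpi : AEMeasurable (fun ω i => X i ω) μ := aemeasurable_pi_lambda _ hXm
  exact hsplit.comp_hasLaw ⟨hXpi, hpi⟩

lemma ae_linearIndependent_and_exists_isStrictMax {N M L : ℕ} (hN : 1 ≤ N) (hNM : N < M)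
    (hL : 0 < L) :
    ∀ᵐ p ∂(channelLaw N M).prod (codebookLaw L M),
      LinearIndependent ℂ p.1 ∧ ∃ l, IsStrictMax p.1 p.2 l ∧ score p.1 (p.2 l) ≠ 0 := by
  have hmeas : MeasurableSet {p : (Fin N → CVec M) × (Fin L → CVec M) |
      LinearIndependent ℂ p.1 ∧ ∃ l, IsStrictMax p.1 p.2 l ∧ score p.1 (p.2 l) ≠ 0} := by
    have hset : {p : (Fin N → CVec M) × (Fin L → CVec M) |
        LinearIndependent ℂ p.1 ∧ ∃ l, IsStrictMax p.1 p.2 l ∧ score p.1 (p.2 l) ≠ 0} =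
        {p | LinearIndependent ℂ p.1} ∩
          ⋃ l, {p | IsStrictMax p.1 p.2 l} ∩ {p | score p.1 (p.2 l) ≠ 0} := by
      ext p; simp
    rw [hset]
    refine (measurable_fst measurableSet_linearIndependent).inter (MeasurableSet.iUnion fun l =>
      (measurableSet_isStrictMax measurable_fst measurable_snd l).inter ?_)
    exact (measurableSet_eq_fun (measurable_score measurable_fst
      ((measurable_pi_apply l).comp measurable_snd)) measurable_const).compl
  refine (Measure.ae_prod_mem_iff_ae_ae_mem hmeas).2 ?_
  filter_upwards [ae_linearIndependent_channelLaw hNM.le] with h hh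
  filter_upwards [ae_exists_isStrictMax hN hNM hh hL] with w hw using ⟨hh, hw⟩

/-- This makes the tie-breaking rule irrelevant outside a null set. -/
lemma IsStrictMax.eq_of_isSelected {N M L : ℕ} {h : Fin N → CVec M}
    (hh : LinearIndependent ℂ h) {w : Fin L → CVec M} {l l' : Fin L} (hl : IsStrictMax h w l)
    (hl' : IsSelected h w l') : l' = l := by
  by_contra hne
  have h1 := hl l' hne
  rw [score_eq hh, score_eq hh] at h1
  exact absurd (hl' l) (not_le.mpr h1)

lemma hasLaw_norm_effChannel_sq {Ω : Type*} [MeasurableSpace Ω] {μ : Measure Ω}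
    [IsProbabilityMeasure μ] {K M N B : ℕ} (hN : 1 ≤ N) (hNM : N < M)
    {h : Fin K → Fin N → Ω → CVec M} {w : Fin K → Fin (2 ^ B) → Ω → CVec M}
    (hsys : IsDownlink μ h w) {sel : Fin K → Ω → Fin (2 ^ B)}
    (hsel : ∀ k, ∀ᵐ ω ∂μ,
      IsSelected (fun i => h k i ω) (fun l => w k l ω) (sel k ω)) (k : Fin K) :
    HasLaw (fun ω => ‖effChannel (fun i => h k i ω) (w k (sel k ω) ω)‖ ^ 2)
      ((gaussianVec (M - N + 1)).map (fun z => ‖z‖ ^ 2)) μ := by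
  have hjoint := hsys.hasLaw_channel_codebook (by omega) k
  have hgain : HasLaw (fun p : (Fin N → CVec M) × (Fin (2 ^ B) → CVec M) => atMax gain p.1 p.2)
      ((gaussianVec (M - N + 1)).map (fun z => ‖z‖ ^ 2))
      ((channelLaw N M).prod (codebookLaw (2 ^ B) M)) :=
    ⟨measurable_atMax_gain.aemeasurable, map_atMax_gain hN hNM (by positivity)⟩
  -- `sel` need not be measurable: almost everywhere equality with the measurable `atMax gain`
  -- suffices.
  refine (hgain.comp hjoint).congr ?_
  have hregular := ae_linearIndependent_and_exists_isStrictMax (L := 2 ^ B) hN hNM (by positivity)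
  have hregular' := ae_of_ae_map hjoint.aemeasurable (hjoint.map_eq.symm ▸ hregular)
  filter_upwards [hregular', hsel k] with ω ⟨hli, l, hl, hl0⟩ hs
  have hsl := hl.eq_of_isSelected hli hs
  simp only [Function.comp_apply]
  rw [hsl, atMax_eq _ hl]
  refine norm_effChannel_sq hli fun h0 => hl0 ?_
  rw [score_eq hli, h0]
  simp

end QBC

theorem lemma3 {Ω : Type*} [MeasurableSpace Ω] (μ : Measure Ω) [IsProbabilityMeasure μ]
    (K M N B : ℕ) (hN : 1 ≤ N) (hNM : N < M)
    (h : Fin K → Fin N → Ω → QBC.CVec M)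
    (w : Fin K → Fin (2 ^ B) → Ω → QBC.CVec M)
    (hsys : QBC.IsDownlink μ h w)
    (sel : Fin K → Ω → Fin (2 ^ B))
    (hsel : ∀ k, ∀ᵐ ω ∂μ,
      QBC.IsSelected (fun i => h k i ω) (fun l => w k l ω) (sel k ω))
    (k : Fin K) :
    HasLaw (fun ω => 2 * ‖QBC.effChannel (fun i => h k i ω) (w k (sel k ω) ω)‖ ^ 2)
        (QBC.chiSquared (2 * (M - N + 1))) μ ∧
      HasLaw (fun ω => ‖QBC.effChannel (fun i => h k i ω) (w k (sel k ω) ω)‖ ^ 2)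
        ((QBC.gaussianVec (M - N + 1)).map (fun z => ‖z‖ ^ 2)) μ := by
  have key := QBC.hasLaw_norm_effChannel_sq hN hNM hsys hsel k
  refine ⟨?_, key⟩
  have h2 : HasLaw (fun x : ℝ => 2 * x) (QBC.chiSquared (2 * (M - N + 1)))
      ((QBC.gaussianVec (M - N + 1)).map (fun z => ‖z‖ ^ 2)) :=
    ⟨by fun_prop, by
      rw [QBC.chiSquared_two_mul, Measure.map_map (by fun_prop) (by fun_prop)]; rfl⟩
  exact h2.comp key
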